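/- Let $\mathcal A$ be a Grothendieck category. An object $M$ is \emph{finitely generated} if every family of subobjects of $M$ with sum $M$ has a finite subfamily with sum $M$, and \emph{finitely cogenerated} if every family of subobjects of $M$ with intersection $0$ has a finite subfamily with intersection $0$. A subobject $K$ of $L$ is \emph{essential} if $K\cap X=0$ implies $X=0$, and \emph{superfluous} if $K+X=L$ implies $X=L$, for every subobject $X$ of $L$. A monomorphism $f$ is \emph{essential} if every $h$ such that $hf$ is a monomorphism is itself a monomorphism, and an epimorphism $f$ is \emph{superfluous} if every $h$ such that $fh$ is an epimorphism is itself an epimorphism. An object $M$ is called \begin{itemize} \item \emph{self-CS-Rickart} if for every $f:M\to M$ there are an essential monomorphism $e:\mathrm{Ker}(f)\to L$ and a section (split monomorphism) $s:L\to M$ with $\ker(f)=se$; \emph{dual self-CS-Rickart} if for every $f:M\to M$ there are a retraction (split epimorphism) $r:M\to P$ and a superfluous epimorphism $t:P\to\mathrm{Coker}(f)$ with $\mathrm{coker}(f)=tr$; \item \emph{singular} if $M\cong L/K$ for some object $L$ and some essential subobject $K$ of $L$; \emph{small} if $M$ is isomorphic to a superfluous subobject of some object $L$; \item \emph{weakly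 hereditary} (respectively \emph{weakly semihereditary}) if every subobject (respectively every finitely generated subobject) of $M$ is the direct sum of a singular subobject and a projective subobject; \item \emph{weakly cohereditary} (respectively \emph{weakly semicohereditary}) if every factor object (respectively every finitely cogenerated factor object) of $M$ is the direct sum of a small subobject and an injective subobject. \end{itemize} (1) Assume that $\mathcal A$ has a (small) family of finitely generated projective generators. Then every projective object of $\mathcal A$ is weakly hereditary if and only if every projective object of $\mathcal A$ is self-CS-Rickart; and every finitely generated projective object of $\mathcal A$ is weakly semihereditary if and only if every finitely generated projective object of $\mathcal A$ is self-CS-Rickart. (2) Assume that $\mathcal A$ is locally finitely generated, that is, it has a (small) family of finitely generated generators. Then every injective object of $\mathcal A$ is weakly cohereditary if and only if every injective object of $\mathcal A$ is dual self-CS-Rickart; and every finitely cogenerated injective object of $\mathcal A$ is weakly semicohereditary if and only if every finitely cogenerated injective object of $\mathcal A$ is dual self-CS-Rickart. -/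

import Mathlib

open CategoryTheory CategoryTheory.Limits

universe w v u

namespace CSRickart

section Defs

variable {C : Type u} [Category.{v} C] [Abelian C]

/-- A monomorphism `f` is essential if `h` is a monomorphism whenever `h ∘ f` is. -/
def EssentialMono {M N : C} (f : M ⟶ N) : Prop :=
  Mono f ∧ ∀ ⦃P : C⦄ (h : N ⟶ P), Mono (f ≫ h) → Mono h

/-- An epimorphism `f` is superfluous if `h` is an epimorphism whenever `f ∘ h` is. -/
def SuperfluousEpi {M N : C} (f : M ⟶ N) : Prop :=
  Epi f ∧ ∀ ⦃P : C⦄ (h : P ⟶ M), Epi (h ≫ f) → Epi h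

/-- A subobject `K` of `L` is essential if `K ∩ X = 0` implies `X = 0`. -/
def EssentialSubobject {L : C} (K : Subobject L) : Prop :=
  ∀ X : Subobject L, K ⊓ X = ⊥ → X = ⊥

/-- A subobject `K` of `L` is superfluous if `K + X = L` implies `X = L`. -/
def SuperfluousSubobject {L : C} (K : Subobject L) : Prop :=
  ∀ X : Subobject L, K ⊔ X = ⊤ → X = ⊤

/-- `N` is `M`-CS-Rickart: the kernel of every `f : M ⟶ N` is an essential monomorphism
followed by a section. -/
def RelCSRickart (M N : C) : Prop :=
  ∀ f : M ⟶ N, ∃ (L : C) (e : kernel f ⟶ L) (s : L ⟶ M),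
    EssentialMono e ∧ IsSplitMono s ∧ e ≫ s = kernel.ι f

/-- `N` is dual `M`-CS-Rickart: the cokernel of every `f : M ⟶ N` is a retraction followed by a
superfluous epimorphism. -/
def DualRelCSRickart (M N : C) : Prop :=
  ∀ f : M ⟶ N, ∃ (P : C) (r : N ⟶ P) (t : P ⟶ cokernel f),
    IsSplitEpi r ∧ SuperfluousEpi t ∧ r ≫ t = cokernel.π f

def SelfCSRickart (M : C) : Prop := RelCSRickart M M

def DualSelfCSRickart (M : C) : Prop := DualRelCSRickart M M

/-- `M ≅ L / K` for some object `L` and some essential subobject `K` of `L`. -/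
def Singular (M : C) : Prop :=
  ∃ (L : C) (K : Subobject L), EssentialSubobject K ∧ Nonempty (M ≅ cokernel K.arrow)

/-- `M` is (isomorphic to) a superfluous subobject of some object `L`. -/
def SmallObj (M : C) : Prop :=
  ∃ (L : C) (K : Subobject L), SuperfluousSubobject K ∧ Nonempty (M ≅ (K : C))

/-- Every family of subobjects of `M` with sum `M` has a finite subfamily with sum `M`. -/
def FinGen (M : C) : Prop :=
  ∀ S : Set (Subobject M), IsLUB S ⊤ →
    ∃ t : Finset (Subobject M), (t : Set (Subobject M)) ⊆ S ∧ t.sup id = ⊤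

/-- Every family of subobjects of `M` with zero intersection has a finite subfamily with zero
intersection. -/
def FinCogen (M : C) : Prop :=
  ∀ S : Set (Subobject M), IsGLB S ⊥ →
    ∃ t : Finset (Subobject M), (t : Set (Subobject M)) ⊆ S ∧ t.inf id = ⊥

/-- Every subobject of `M` is the direct sum of a singular and a projective object. -/
def WeaklyHereditary (M : C) : Prop :=
  ∀ ⦃N : C⦄ (i : N ⟶ M), Mono i →
    ∃ Q Z : C, Singular Q ∧ Projective Z ∧ Nonempty (N ≅ Q ⊞ Z)

/-- Every finitely generated subobject of `M` is the direct sum of a singular and a projective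
object. -/
def WeaklySemihereditary (M : C) : Prop :=
  ∀ ⦃N : C⦄ (i : N ⟶ M), Mono i → FinGen N →
    ∃ Q Z : C, Singular Q ∧ Projective Z ∧ Nonempty (N ≅ Q ⊞ Z)

/-- Every factor object of `M` is the direct sum of a small and an injective object. -/
def WeaklyCohereditary (M : C) : Prop :=
  ∀ ⦃N : C⦄ (p : M ⟶ N), Epi p →
    ∃ Q Z : C, SmallObj Q ∧ Injective Z ∧ Nonempty (N ≅ Q ⊞ Z)

/-- Every finitely cogenerated factor object of `M` is the direct sum of a small and an injective
object. -/
def WeaklySemicohereditary (M : C) : Prop :=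
  ∀ ⦃N : C⦄ (p : M ⟶ N), Epi p → FinCogen N →
    ∃ Q Z : C, SmallObj Q ∧ Injective Z ∧ Nonempty (N ≅ Q ⊞ Z)

end Defs

section Generators

variable (C : Type u) [Category.{v} C] [Abelian C]

/-- `C` has a (small) family of finitely generated projective generators. -/
def HasFinGenProjectiveGenerators : Prop :=
  ∃ (ι : Type w) (G : ι → C), (∀ i, FinGen (G i) ∧ Projective (G i)) ∧
    (ObjectProperty.ofObj G).IsSeparating

/-- `C` has a (small) family of finitely generated generators. -/
def LocallyFinGen : Prop :=
  ∃ (ι : Type w) (G : ι → C), (∀ i, FinGen (G i)) ∧ (ObjectProperty.ofObj G).IsSeparating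

end Generators

end CSRickart

/-! Let `N` be the image of an endomorphism `f` of a projective `M`. If `N ≅ Q ⊞ Z` with `Q`
singular and `Z` projective, then `M ⟶ Z` splits. Its kernel `L` is a projective summand of `M`
containing `Ker f`, and `L / Ker f ≅ Q`. Lifting `L ⟶ Q` along a presentation of the singular object
`Q` shows that `Ker f` is essential in `L` (`selfCSRickart_of_image`). Conversely, if `Ker f` is
essential in a summand `L` of `M`, then `N ≅ M / Ker f` is the sum of the singular object `L / Ker
f` and the projective object `M / L` (`SelfCSRickart.exists_iso_biprod`).

So being CS-Rickart controls exactly the subobjects that are images of endomorphisms. To reach an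
arbitrary subobject `N` of `M`, cover it by a projective `P`: then `N` is the image of an
endomorphism of `P ⊞ M`. The injective case is dual, with `N` a quotient of `M` embedded in an
injective `E` and `M ⊞ E` as the ambient object.

It remains to choose `P` and `E` within the right class. Coproducts or finite sums of the generators
provide `P`. An injective embedding provides `E`, and for finitely cogenerated `N` the injective
hull does, because an essential extension of a finitely cogenerated object is finitely cogenerated.
-/

namespace CSRickart

/-! ### Essential and superfluous morphisms; singular and small objects. -/

section Essential

variable {C : Type u} [Category.{v} C] [Abelian C]

/-- `k ≫ S.g` is a monomorphism exactly when `k` is one and its image meets `S.X₁` trivially. The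
test morphism `h` is then `cokernel.π k` in one direction; in the other, `k` is the kernel of the
given `h`. -/
theorem essentialMono_iff_of_exact {S : ShortComplex C} (hS : S.Exact) [Mono S.f] :
    EssentialMono S.f ↔ ∀ ⦃T : C⦄ (k : T ⟶ S.X₂), Mono (k ≫ S.g) → k = 0 := by
  constructor
  · intro h T k hk
    have hk' : Mono k := mono_of_mono k S.g
    have : Mono (cokernel.π k) := by
      refine h.2 _ (Preadditive.mono_of_cancel_zero _ fun x hx => ?_)
      obtain ⟨y, hy⟩ := (ShortComplex.exact_cokernel k).lift' (x ≫ S.f) (by simpa using hx)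
      dsimp at y hy
      have hy0 : y = 0 := by
        rw [← cancel_mono (k ≫ S.g), ← Category.assoc, hy]
        simp
      rw [← cancel_mono S.f, ← hy, hy0]
      simp
    rw [← cancel_mono (cokernel.π k)]
    simp
  · intro h
    refine ⟨inferInstance, fun P m hm => Preadditive.mono_of_kernel_zero (h _ ?_)⟩
    refine Preadditive.mono_of_cancel_zero _ fun x hx => ?_
    obtain ⟨y, hy⟩ := hS.lift' (x ≫ kernel.ι m) (by simpa using hx)
    have hy0 : y = 0 := by
      rw [← cancel_mono (S.f ≫ m), ← Category.assoc, hy]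
      simp
    rw [← cancel_mono (kernel.ι m), ← hy, hy0]
    simp

theorem superfluousEpi_iff_of_exact {S : ShortComplex C} (hS : S.Exact) [Epi S.g] :
    SuperfluousEpi S.g ↔ ∀ ⦃T : C⦄ (c : S.X₂ ⟶ T), Epi (S.f ≫ c) → c = 0 := by
  constructor
  · intro h T c hc
    have hc' : Epi c := epi_of_epi S.f c
    have : Epi (kernel.ι c) := by
      refine h.2 _ (Preadditive.epi_of_cancel_zero _ fun x hx => ?_)
      obtain ⟨y, hy⟩ := (ShortComplex.exact_kernel c).desc' (S.g ≫ x) (by simpa using hx)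
      dsimp at y hy
      have hy0 : y = 0 := by
        rw [← cancel_epi (S.f ≫ c), Category.assoc, hy]
        simp
      rw [← cancel_epi S.g, ← hy, hy0]
      simp
    rw [← cancel_epi (kernel.ι c)]
    simp
  · intro h
    refine ⟨inferInstance, fun P m hm => Preadditive.epi_of_cokernel_zero (h _ ?_)⟩
    refine Preadditive.epi_of_cancel_zero _ fun x hx => ?_
    obtain ⟨y, hy⟩ := hS.desc' (cokernel.π m ≫ x) (by simpa using hx)
    have hy0 : y = 0 := by
      rw [← cancel_epi (m ≫ S.g), Category.assoc, hy]
      simp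
    rw [← cancel_epi (cokernel.π m), ← hy, hy0]
    simp

theorem inf_eq_bot_iff_mono {L : C} (K X : Subobject L) :
    K ⊓ X = ⊥ ↔ Mono (X.arrow ≫ cokernel.π K.arrow) := by
  constructor
  · intro h
    refine Preadditive.mono_of_cancel_zero _ fun y hy => ?_
    obtain ⟨z, hz⟩ := (ShortComplex.exact_cokernel K.arrow).lift' (y ≫ X.arrow) (by simpa using hy)
    dsimp at z hz
    have h1 : (K ⊓ X).Factors (y ≫ X.arrow) := by
      rw [Subobject.inf_factors]
      exact ⟨(Subobject.factors_iff _ _).2 ⟨z, hz⟩, (Subobject.factors_iff _ _).2 ⟨y, rfl⟩⟩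
    rw [h, Subobject.bot_factors_iff_zero] at h1
    rw [← cancel_mono X.arrow, h1, zero_comp]
  · intro h
    have h0 : Subobject.ofLE (K ⊓ X) X inf_le_right = 0 := by
      rw [← cancel_mono (X.arrow ≫ cokernel.π K.arrow), Subobject.ofLE_arrow_assoc, zero_comp,
        ← Subobject.ofLE_arrow (inf_le_left : K ⊓ X ≤ K), Category.assoc, cokernel.condition,
        comp_zero]
    rw [← Subobject.mk_arrow (K ⊓ X), Subobject.mk_eq_bot_iff_zero,
      ← Subobject.ofLE_arrow (inf_le_right : K ⊓ X ≤ X), h0, zero_comp]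

theorem arrow_eq_zero_iff {L : C} (X : Subobject L) : X.arrow = 0 ↔ X = ⊥ := by
  rw [← Subobject.mk_eq_bot_iff_zero, Subobject.mk_arrow]

theorem cokernel_π_eq_zero_iff {L : C} (X : Subobject L) : cokernel.π X.arrow = 0 ↔ X = ⊤ := by
  rw [← Subobject.isIso_arrow_iff_eq_top]
  constructor
  · intro h
    have := Preadditive.epi_of_cokernel_zero h
    exact isIso_of_mono_of_epi _
  · intro h
    exact cokernel.π_of_epi _

theorem sup_eq_top_iff_epi {L : C} (K X : Subobject L) :
    K ⊔ X = ⊤ ↔ Epi (K.arrow ≫ cokernel.π X.arrow) := by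
  constructor
  · intro h
    refine Preadditive.epi_of_cancel_zero _ fun y hy => ?_
    have h1 : K ⊔ X ≤ kernelSubobject (cokernel.π X.arrow ≫ y) :=
      sup_le (le_kernelSubobject _ _ (by simpa using hy)) (le_kernelSubobject _ _ (by simp))
    rw [h, top_le_iff, ← Subobject.isIso_arrow_iff_eq_top] at h1
    have h2 := kernelSubobject_arrow_comp (cokernel.π X.arrow ≫ y)
    have h3 : cokernel.π X.arrow ≫ y = 0 := by
      rw [← cancel_epi (kernelSubobject (cokernel.π X.arrow ≫ y)).arrow, h2, comp_zero]
    rw [← cancel_epi (cokernel.π X.arrow), h3, comp_zero]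
  · intro h
    rw [← cokernel_π_eq_zero_iff]
    obtain ⟨y, hy⟩ : ∃ y, cokernel.π X.arrow ≫ y = cokernel.π (K ⊔ X).arrow :=
      ⟨cokernel.desc _ _ (by
        rw [← Subobject.ofLE_arrow (le_sup_right : X ≤ K ⊔ X), Category.assoc,
          cokernel.condition, comp_zero]), cokernel.π_desc _ _ _⟩
    have : y = 0 := by
      rw [← cancel_epi (K.arrow ≫ cokernel.π X.arrow), Category.assoc, hy,
        ← Subobject.ofLE_arrow (le_sup_left : K ≤ K ⊔ X), Category.assoc,
          cokernel.condition, comp_zero, comp_zero]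
    rw [← hy, this, comp_zero]

theorem essentialSubobject_iff {L : C} (K : Subobject L) :
    EssentialSubobject K ↔ EssentialMono K.arrow := by
  rw [essentialMono_iff_of_exact (ShortComplex.exact_cokernel K.arrow)]
  dsimp
  constructor
  · intro h T k hk
    have : Mono k := mono_of_mono k (cokernel.π K.arrow)
    rw [← Subobject.mk_eq_bot_iff_zero]
    refine h _ ((inf_eq_bot_iff_mono _ _).2 ?_)
    rw [← Subobject.underlyingIso_hom_comp_eq_mk, Category.assoc]
    infer_instance
  · intro h X hX
    exact (arrow_eq_zero_iff X).1 (h _ ((inf_eq_bot_iff_mono _ _).1 hX))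

theorem superfluousSubobject_iff {L : C} (K : Subobject L) :
    SuperfluousSubobject K ↔ SuperfluousEpi (cokernel.π K.arrow) := by
  rw [superfluousEpi_iff_of_exact (ShortComplex.exact_cokernel K.arrow)]
  dsimp
  constructor
  · intro h T c hc
    have : Epi c := epi_of_epi K.arrow c
    have hker : kernelSubobject c = ⊤ := by
      refine h _ ((sup_eq_top_iff_epi _ _).2 ?_)
      refine Preadditive.epi_of_cancel_zero _ fun x hx => ?_
      obtain ⟨y, hy⟩ := (ShortComplex.exact_kernel c).desc'
        (cokernel.π (kernelSubobject c).arrow ≫ x) (by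
          rw [← cancel_epi (kernelSubobjectIso c).hom]
          dsimp
          rw [kernelSubobject_arrow_assoc, cokernel.condition_assoc, zero_comp, comp_zero])
      dsimp at y hy
      have hy0 : y = 0 := by
        rw [← cancel_epi (K.arrow ≫ c), Category.assoc, hy]
        simpa using hx
      rw [← cancel_epi (cokernel.π (kernelSubobject c).arrow), ← hy, hy0]
      simp
    rw [← Subobject.isIso_arrow_iff_eq_top] at hker
    rw [← cancel_epi (kernelSubobject c).arrow]
    simp
  · intro h X hX
    exact (cokernel_π_eq_zero_iff X).1 (h _ ((sup_eq_top_iff_epi _ _).1 hX))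

theorem EssentialMono.essentialSubobject_mk {K L : C} {e : K ⟶ L} [Mono e]
    (he : EssentialMono e) : EssentialSubobject (Subobject.mk e) := by
  refine (essentialSubobject_iff _).2 ⟨inferInstance, fun P h hh => he.2 h ?_⟩
  rw [← Subobject.underlyingIso_arrow e, Category.assoc]
  infer_instance

theorem EssentialMono.singular_cokernel {K L : C} {e : K ⟶ L} (he : EssentialMono e) :
    Singular (cokernel e) := by
  have := he.1
  exact ⟨L, Subobject.mk e, he.essentialSubobject_mk,
    ⟨(cokernelEpiComp (Subobject.underlyingIso e).hom e).symm ≪≫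
      cokernelIsoOfEq (Subobject.underlyingIso_hom_comp_eq_mk e)⟩⟩

theorem SuperfluousEpi.smallObj_kernel {K L : C} {t : K ⟶ L} (ht : SuperfluousEpi t) :
    SmallObj (kernel t) := by
  have := ht.1
  refine ⟨K, Subobject.mk (kernel.ι t), (superfluousSubobject_iff _).2 ⟨inferInstance,
    fun P h hh => ?_⟩, ⟨(Subobject.underlyingIso _).symm⟩⟩
  refine ht.2 h (Preadditive.epi_of_cancel_zero _ fun x hx => ?_)
  obtain ⟨y, hy⟩ : ∃ y, cokernel.π (Subobject.mk (kernel.ι t)).arrow ≫ y = t ≫ x :=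
    ⟨cokernel.desc _ _ (by
      rw [← Subobject.underlyingIso_hom_comp_eq_mk]; simp), cokernel.π_desc _ _ _⟩
  have hy0 : y = 0 := by
    rw [← cancel_epi (h ≫ cokernel.π (Subobject.mk (kernel.ι t)).arrow), Category.assoc, hy]
    simpa using hx
  rw [← cancel_epi t, ← hy, hy0]
  simp

/-- A projective object mapping to a singular object has essential kernel. -/
theorem essentialMono_of_exact_of_singular {S : ShortComplex C} (hS : S.Exact) [Mono S.f]
    [Projective S.X₂] (hQ : Singular S.X₃) : EssentialMono S.f := by
  obtain ⟨L, K, hK, ⟨i⟩⟩ := hQ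
  rw [essentialSubobject_iff, essentialMono_iff_of_exact (ShortComplex.exact_cokernel K.arrow)] at hK
  dsimp at hK
  rw [essentialMono_iff_of_exact hS]
  intro T k hk
  have hlift := Projective.factorThru_comp (S.g ≫ i.hom) (cokernel.π K.arrow)
  set l := Projective.factorThru (S.g ≫ i.hom) (cokernel.π K.arrow)
  have hm : Mono ((k ≫ l) ≫ cokernel.π K.arrow) := by
    rw [Category.assoc, hlift, ← Category.assoc]
    infer_instance
  have h0 := hK (k ≫ l) hm
  -- The zero morphism `k ≫ l` is the first factor of a monomorphism out of `T`, so `T` is zero.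
  have hT : 𝟙 T = 0 := by
    rw [← cancel_mono ((k ≫ l) ≫ cokernel.π K.arrow), h0]
    simp
  rw [← Category.id_comp k, hT, zero_comp]

/-- A small object mapping to an injective object has superfluous cokernel. -/
theorem superfluousEpi_of_exact_of_smallObj {S : ShortComplex C} (hS : S.Exact) [Epi S.g]
    [Injective S.X₂] (hQ : SmallObj S.X₁) : SuperfluousEpi S.g := by
  obtain ⟨L, K, hK, ⟨i⟩⟩ := hQ
  rw [superfluousSubobject_iff,
    superfluousEpi_iff_of_exact (ShortComplex.exact_cokernel K.arrow)] at hK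
  dsimp at hK
  rw [superfluousEpi_iff_of_exact hS]
  intro T c hc
  have hext := Injective.comp_factorThru (i.inv ≫ S.f) K.arrow
  set l := Injective.factorThru (i.inv ≫ S.f) K.arrow
  have hm : Epi (K.arrow ≫ l ≫ c) := by
    rw [← Category.assoc, hext, Category.assoc]
    infer_instance
  have h0 := hK (l ≫ c) hm
  have hT : 𝟙 T = 0 := by
    rw [← cancel_epi (K.arrow ≫ l ≫ c), h0]
    simp
  rw [← Category.comp_id c, hT, comp_zero]

end Essential

/-! ### Splitting the image of an endomorphism, in both directions. -/

section Decomposition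

variable {C : Type u} [Category.{v} C] [Abelian C]

/-- Since `L` is a summand of `X` containing `K`, the quotient `X / K` splits as `L / K ⊞ X / L`. -/
theorem nonempty_iso_biprod_cokernel {K L X N : C} {e : K ⟶ L} {s : L ⟶ X} [IsSplitMono s]
    {p : X ⟶ N} [Epi p] (w : (e ≫ s) ≫ p = 0) (hex : (ShortComplex.mk (e ≫ s) p w).Exact) :
    Nonempty (N ≅ cokernel e ⊞ cokernel s) := by
  obtain ⟨b, hb⟩ := hex.desc' (retraction s ≫ cokernel.π e) (by simp)
  obtain ⟨c, hc⟩ := hex.desc' (cokernel.π s) (by simp)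
  dsimp at b hb c hc
  let a : cokernel e ⟶ N := cokernel.desc e (s ≫ p) (by simpa using w)
  let d : cokernel s ⟶ N := cokernel.desc s ((𝟙 X - retraction s ≫ s) ≫ p) (by simp)
  refine ⟨⟨biprod.lift b c, biprod.desc a d, ?_, ?_⟩⟩
  · rw [biprod.lift_desc, ← cancel_epi p, Preadditive.comp_add, reassoc_of% hb, reassoc_of% hc]
    simp [a, d]
  · ext <;> simp [a, d, hb, hc]

theorem nonempty_iso_biprod_kernel {K P X N : C} {r : X ⟶ P} {t : P ⟶ K} [IsSplitEpi r]
    {j : N ⟶ X} [Mono j] (w : j ≫ r ≫ t = 0) (hex : (ShortComplex.mk j (r ≫ t) w).Exact) :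
    Nonempty (N ≅ kernel t ⊞ kernel r) := by
  obtain ⟨b, hb⟩ := hex.lift' (kernel.ι t ≫ section_ r) (by simp)
  obtain ⟨c, hc⟩ := hex.lift' (kernel.ι r) (by simp)
  dsimp at b hb c hc
  let a : N ⟶ kernel t := kernel.lift t (j ≫ r) (by simpa using w)
  let d : N ⟶ kernel r := kernel.lift r (j ≫ (𝟙 X - r ≫ section_ r)) (by simp)
  refine ⟨⟨biprod.lift a d, biprod.desc b c, ?_, ?_⟩⟩
  · rw [biprod.lift_desc, ← cancel_mono j, Preadditive.add_comp, Category.assoc, Category.assoc,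
      hb, hc]
    simp [a, d]
  · ext <;> simp [a, d, reassoc_of% hb, reassoc_of% hc, hb, hc]

theorem SelfCSRickart.exists_iso_biprod {X N : C} (hX : SelfCSRickart X) [Projective X]
    (p : X ⟶ N) [Epi p] (j : N ⟶ X) [Mono j] :
    ∃ Q Z : C, Singular Q ∧ Projective Z ∧ Nonempty (N ≅ Q ⊞ Z) := by
  obtain ⟨L, e, s, he, hs, hes⟩ := hX (p ≫ j)
  have w : (e ≫ s) ≫ p = 0 := by
    rw [← cancel_mono j, hes]
    simp
  have hex : (ShortComplex.mk (e ≫ s) p w).Exact := by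
    have : Mono (e ≫ s) := by rw [hes]; infer_instance
    refine ShortComplex.exact_of_f_is_kernel _ (KernelFork.IsLimit.ofι' _ _ fun k hk =>
      ⟨kernel.lift (p ≫ j) k (by simp [reassoc_of% hk]), ?_⟩)
    simp [hes]
  have hZ : Projective (cokernel s) :=
    Retract.projective (Y := X)
      { i := cokernel.desc s (𝟙 X - retraction s ≫ s) (by simp)
        r := cokernel.π s
        retract := by ext; simp }
  exact ⟨_, _, he.singular_cokernel, hZ, nonempty_iso_biprod_cokernel w hex⟩

theorem DualSelfCSRickart.exists_iso_biprod {X N : C} (hX : DualSelfCSRickart X) [Injective X]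
    (p : X ⟶ N) [Epi p] (j : N ⟶ X) [Mono j] :
    ∃ Q Z : C, SmallObj Q ∧ Injective Z ∧ Nonempty (N ≅ Q ⊞ Z) := by
  obtain ⟨P, r, t, hr, ht, hrt⟩ := hX (p ≫ j)
  have w : j ≫ r ≫ t = 0 := by
    rw [← cancel_epi p, hrt, ← Category.assoc, cokernel.condition, comp_zero]
  have hex : (ShortComplex.mk j (r ≫ t) w).Exact := by
    have : Epi (r ≫ t) := by rw [hrt]; infer_instance
    refine ShortComplex.exact_of_g_is_cokernel _ (CokernelCofork.IsColimit.ofπ' _ _ fun k hk =>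
      ⟨cokernel.desc (p ≫ j) k (by simp [hk]), ?_⟩)
    simp [hrt]
  have hZ : Injective (kernel r) :=
    Retract.injective (Y := X)
      { i := kernel.ι r
        r := kernel.lift r (𝟙 X - r ≫ section_ r) (by simp)
        retract := by ext; simp }
  exact ⟨_, _, ht.smallObj_kernel, hZ, nonempty_iso_biprod_kernel w hex⟩

theorem selfCSRickart_of_image {M : C} [Projective M]
    (h : ∀ f : M ⟶ M, ∃ Q Z : C, Singular Q ∧ Projective Z ∧ Nonempty (image f ≅ Q ⊞ Z)) :
    SelfCSRickart M := by
  intro f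
  obtain ⟨Q, Z, hQ, hZ, ⟨i⟩⟩ := h f
  let q : M ⟶ Z := factorThruImage f ≫ i.hom ≫ biprod.snd
  obtain ⟨σ, hσ⟩ : ∃ σ, σ ≫ q = 𝟙 Z := ⟨Projective.factorThru (𝟙 Z) q, by simp⟩
  have hfac : kernel.ι f ≫ factorThruImage f = 0 := by
    rw [← cancel_mono (image.ι f)]
    simp
  let e : kernel f ⟶ kernel q := kernel.lift q (kernel.ι f) (by simp [q, reassoc_of% hfac])
  have he : e ≫ kernel.ι q = kernel.ι f := kernel.lift_ι _ _ _
  have hmono : Mono e := mono_of_mono_fac he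
  let ρ : M ⟶ kernel q := kernel.lift q (𝟙 M - q ≫ σ) (by simp [hσ])
  have hρ : kernel.ι q ≫ ρ = 𝟙 _ := by ext; simp [ρ]
  have hL : Projective (kernel q) := Retract.projective ⟨kernel.ι q, ρ, hρ⟩
  refine ⟨kernel q, e, kernel.ι q, ?_, ⟨⟨⟨ρ, hρ⟩⟩⟩, he⟩
  -- This complex exhibits `kernel q / kernel f` inside `Q`: an element of `kernel q` has zero
  -- component in `Z`, so it lies in `kernel f` once its `Q` component vanishes.
  let S : ShortComplex C :=
    ShortComplex.mk e (kernel.ι q ≫ factorThruImage f ≫ i.hom ≫ biprod.fst)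
      (by rw [reassoc_of% he, reassoc_of% hfac, zero_comp])
  have hS : S.Exact := by
    refine ShortComplex.exact_of_f_is_kernel _ (KernelFork.IsLimit.ofι' _ _ fun k hk =>
      ⟨kernel.lift f (k ≫ kernel.ι q) ?_, ?_⟩)
    · have h0 : k ≫ kernel.ι q ≫ factorThruImage f ≫ i.hom = 0 := by
        ext
        · simpa [S] using hk
        · simp [q]
      have h1 : k ≫ kernel.ι q ≫ factorThruImage f = 0 := by
        rw [← cancel_mono i.hom]
        simpa using h0
      rw [← image.fac f, Category.assoc, reassoc_of% h1, zero_comp]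
    · rw [← cancel_mono (kernel.ι q)]
      simp [S, he]
  have : Mono S.f := hmono
  have : Projective S.X₂ := hL
  exact essentialMono_of_exact_of_singular hS hQ

theorem dualSelfCSRickart_of_image {M : C} [Injective M]
    (h : ∀ f : M ⟶ M, ∃ Q Z : C, SmallObj Q ∧ Injective Z ∧ Nonempty (image f ≅ Q ⊞ Z)) :
    DualSelfCSRickart M := by
  intro f
  obtain ⟨Q, Z, hQ, hZ, ⟨i⟩⟩ := h f
  let q : Z ⟶ M := biprod.inr ≫ i.inv ≫ image.ι f
  have : Mono (biprod.inr : Z ⟶ Q ⊞ Z) := inferInstance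
  have hqm : Mono q := inferInstanceAs (Mono (biprod.inr ≫ i.inv ≫ image.ι f))
  obtain ⟨σ, hσ⟩ : ∃ σ, q ≫ σ = 𝟙 Z := ⟨Injective.factorThru (𝟙 Z) q, by simp⟩
  have hfac : image.ι f ≫ cokernel.π f = 0 := by
    rw [← cancel_epi (factorThruImage f)]
    simp
  let t : cokernel q ⟶ cokernel f := cokernel.desc q (cokernel.π f) (by simp [q, hfac])
  have ht : cokernel.π q ≫ t = cokernel.π f := cokernel.π_desc _ _ _
  have hepi : Epi t := epi_of_epi_fac ht
  let ρ : cokernel q ⟶ M := cokernel.desc q (𝟙 M - σ ≫ q) (by simp [reassoc_of% hσ])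
  have hρ : ρ ≫ cokernel.π q = 𝟙 _ := by ext; simp [ρ]
  have hL : Injective (cokernel q) := Retract.injective ⟨ρ, cokernel.π q, hρ⟩
  refine ⟨cokernel q, cokernel.π q, t, ⟨⟨⟨ρ, hρ⟩⟩⟩, ?_, ht⟩
  let S : ShortComplex C :=
    ShortComplex.mk (biprod.inl ≫ i.inv ≫ image.ι f ≫ cokernel.π q) t (by simp [ht, hfac])
  have hS : S.Exact := by
    have : Epi S.g := hepi
    refine ShortComplex.exact_of_g_is_cokernel _ (CokernelCofork.IsColimit.ofπ' _ _ fun k hk =>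
      ⟨cokernel.desc f (cokernel.π q ≫ k) ?_, ?_⟩)
    · have h0 : i.inv ≫ image.ι f ≫ cokernel.π q ≫ k = 0 := by
        ext
        · simpa [S] using hk
        · simpa only [q, Category.assoc, zero_comp, comp_zero] using cokernel.condition q =≫ k
      have h1 : image.ι f ≫ cokernel.π q ≫ k = 0 := by
        rw [← cancel_epi i.inv, h0, comp_zero]
      rw [← image.fac f, Category.assoc, h1, comp_zero]
    · rw [← cancel_epi (cokernel.π q)]
      simp [S, reassoc_of% ht]
  have : Epi S.g := hepi
  have : Injective S.X₂ := hL
  exact superfluousEpi_of_exact_of_smallObj hS hQ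

/-- If `N` is a quotient of `P` and a subobject of `M`, it is so for `P ⊞ M` as well. -/
theorem exists_iso_biprod_of_selfCSRickart_biprod {P M N : C} [Projective P] [Projective M]
    (h : SelfCSRickart (P ⊞ M)) (p : P ⟶ N) [Epi p] (i : N ⟶ M) [Mono i] :
    ∃ Q Z : C, Singular Q ∧ Projective Z ∧ Nonempty (N ≅ Q ⊞ Z) :=
  h.exists_iso_biprod (biprod.fst ≫ p) (i ≫ biprod.inr)

theorem exists_iso_biprod_of_dualSelfCSRickart_biprod {P M N : C} [Injective P] [Injective M]
    (h : DualSelfCSRickart (P ⊞ M)) (p : P ⟶ N) [Epi p] (i : N ⟶ M) [Mono i] :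
    ∃ Q Z : C, SmallObj Q ∧ Injective Z ∧ Nonempty (N ≅ Q ⊞ Z) :=
  h.exists_iso_biprod (biprod.fst ≫ p) (i ≫ biprod.inr)

end Decomposition

/-! ### Closure properties of finitely generated and finitely cogenerated objects. -/

section Finiteness

open ZeroObject

/-- Applied to the anti-isomorphism between the subobjects of `M` and of `op M`, this lets results
on finitely generated objects follow from those on finitely cogenerated ones. -/
theorem exists_finset_isLUB_top_iff_of_orderIso {α β : Type*} [PartialOrder α] [OrderTop α]
    [PartialOrder β] [OrderBot β] (e : α ≃o βᵒᵈ) :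
    (∀ S : Set α, IsLUB S ⊤ → ∃ t : Finset α, (t : Set α) ⊆ S ∧ IsLUB (t : Set α) ⊤) ↔
      ∀ S : Set β, IsGLB S ⊥ → ∃ t : Finset β, (t : Set β) ⊆ S ∧ IsGLB (t : Set β) ⊥ := by
  classical
  let f : α → β := fun a => OrderDual.ofDual (e a)
  have hf : Function.Surjective f := e.surjective
  have key (S : Set α) : IsLUB S ⊤ ↔ IsGLB (f '' S) ⊥ := by
    rw [← e.isLUB_image', map_top]
    exact Iff.rfl
  constructor
  · intro h S hS
    obtain ⟨t, ht, hlub⟩ := h (f ⁻¹' S) ((key _).2 (by rwa [Set.image_preimage_eq _ hf]))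
    refine ⟨t.image f, by simpa using ht, ?_⟩
    rw [Finset.coe_image]
    exact (key _).1 hlub
  · intro h S hS
    obtain ⟨t, ht, hglb⟩ := h (f '' S) ((key _).1 hS)
    obtain ⟨t, htS, rfl⟩ := Finset.subset_set_image_iff.1 ht
    rw [Finset.coe_image] at hglb
    exact ⟨t, htS, (key _).2 hglb⟩

variable {C : Type u} [Category.{v} C] [Abelian C]

theorem finCogen_iff {M : C} : FinCogen M ↔ ∀ S : Set (Subobject M), IsGLB S ⊥ →
    ∃ t : Finset (Subobject M), (t : Set (Subobject M)) ⊆ S ∧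
      IsGLB (t : Set (Subobject M)) ⊥ := by
  refine forall₂_congr fun S _ => exists_congr fun t => and_congr_right fun _ => ?_
  have h : IsGLB (t : Set (Subobject M)) (t.inf id) := Finset.isGLB_inf_id
  exact ⟨fun h' => h' ▸ h, fun h' => h.unique h'⟩

theorem finGen_iff {M : C} : FinGen M ↔ ∀ S : Set (Subobject M), IsLUB S ⊤ →
    ∃ t : Finset (Subobject M), (t : Set (Subobject M)) ⊆ S ∧
      IsLUB (t : Set (Subobject M)) ⊤ := by
  refine forall₂_congr fun S _ => exists_congr fun t => and_congr_right fun _ => ?_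
  have h : IsLUB (t : Set (Subobject M)) (t.sup id) := Finset.isLUB_sup_id
  exact ⟨fun h' => h' ▸ h, fun h' => h.unique h'⟩

theorem finGen_iff_finCogen_op {M : C} : FinGen M ↔ FinCogen (Opposite.op M) := by
  rw [finGen_iff, finCogen_iff]
  exact exists_finset_isLUB_top_iff_of_orderIso (Abelian.subobjectIsoSubobjectOp M)

theorem isGLB_bot_iff {M : C} {S : Set (Subobject M)} :
    IsGLB S ⊥ ↔ ∀ Y : Subobject M, (∀ X ∈ S, Y ≤ X) → Y = ⊥ :=
  ⟨fun h _ hY => le_bot_iff.1 (h.2 hY), fun h => ⟨fun _ _ => bot_le, fun _ hY => (h _ hY).le⟩⟩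

theorem map_le_iff {N M : C} (i : N ⟶ M) [Mono i] {Y : Subobject N} {X : Subobject M} :
    (Subobject.map i).obj Y ≤ X ↔ Y ≤ (Subobject.pullback i).obj X :=
  (Subobject.mapPullbackAdj i).gc Y X

theorem map_eq_bot_iff {N M : C} (i : N ⟶ M) [Mono i] {Y : Subobject N} :
    (Subobject.map i).obj Y = ⊥ ↔ Y = ⊥ := by
  rw [← (Subobject.map_obj_injective i).eq_iff (b := ⊥), Subobject.map_bot]

theorem exists_map_eq {C : Type u} [Category.{v} C] {N M : C} (i : N ⟶ M) [Mono i] {Y : Subobject M} (h : Y ≤ Subobject.mk i) :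
    ∃ Y' : Subobject N, (Subobject.map i).obj Y' = Y :=
  ⟨Subobject.mk (Y.ofLEMk i h), by
    rw [Subobject.map_mk]
    exact Subobject.mk_eq_of_comm _ (Iso.refl _) (by simp)⟩

/-- Intersecting the family with `N` gives a family of zero intersection in `N`, to which finite
cogeneration applies. -/
theorem FinCogen.exists_finset {N M : C} (hN : FinCogen N) (i : N ⟶ M) [Mono i]
    {S : Set (Subobject M)} (hS : IsGLB S ⊥) :
    ∃ t : Finset (Subobject M), (t : Set (Subobject M)) ⊆ S ∧
      ∀ Y ≤ Subobject.mk i, (∀ X ∈ t, Y ≤ X) → Y = ⊥ := by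
  classical
  rw [isGLB_bot_iff] at hS
  obtain ⟨t, ht, h⟩ := finCogen_iff.1 hN ((Subobject.pullback i).obj '' S) (isGLB_bot_iff.2
    fun Y hY => (map_eq_bot_iff i).1 (hS _ fun X hX =>
      (map_le_iff i).2 (hY _ (Set.mem_image_of_mem _ hX))))
  obtain ⟨t, htS, rfl⟩ := Finset.subset_set_image_iff.1 ht
  refine ⟨t, htS, fun Y hY hYt => ?_⟩
  obtain ⟨Y, rfl⟩ := exists_map_eq i hY
  rw [map_eq_bot_iff]
  refine isGLB_bot_iff.1 h Y fun X hX => ?_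
  obtain ⟨X, hXt, rfl⟩ := Finset.mem_image.1 hX
  exact (map_le_iff i).1 (hYt X hXt)

theorem FinCogen.of_mono {N M : C} (hM : FinCogen M) (i : N ⟶ M) [Mono i] : FinCogen N := by
  classical
  rw [finCogen_iff] at hM ⊢
  intro S hS
  rw [isGLB_bot_iff] at hS
  -- Adding `⊤`, whose image is `N` itself, forces lower bounds to lie in `N` even when `S` is
  -- empty; it is erased from the finite subfamily afterwards.
  obtain ⟨t, ht, h⟩ := hM ((Subobject.map i).obj '' insert ⊤ S) (isGLB_bot_iff.2 fun Y hY => by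
    obtain ⟨Y, rfl⟩ := exists_map_eq i (Y := Y) (by
      rw [← Subobject.map_top]
      exact hY _ (Set.mem_image_of_mem _ (Set.mem_insert _ _)))
    rw [map_eq_bot_iff]
    refine hS Y fun X hX => ?_
    have := hY _ (Set.mem_image_of_mem _ (Set.mem_insert_of_mem _ hX))
    rwa [map_le_iff, Subobject.pullback_map_self] at this)
  obtain ⟨t, htS, rfl⟩ := Finset.subset_set_image_iff.1 ht
  refine ⟨t.erase ⊤, by simpa [Set.sdiff_subset_iff] using htS, isGLB_bot_iff.2 fun Y hY => ?_⟩
  rw [← map_eq_bot_iff i]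
  refine isGLB_bot_iff.1 h _ fun X hX => ?_
  obtain ⟨X, hXt, rfl⟩ := Finset.mem_image.1 hX
  refine (Subobject.map i).monotone ?_
  by_cases hX' : X = ⊤
  · rw [hX']
    exact le_top
  · exact hY _ (by simp [hX', hXt])

theorem FinCogen.of_essential {N M : C} (hN : FinCogen N) (i : N ⟶ M) [Mono i]
    (hi : EssentialSubobject (Subobject.mk i)) : FinCogen M := by
  refine finCogen_iff.2 fun S hS => ?_
  obtain ⟨t, ht, h⟩ := hN.exists_finset i hS
  exact ⟨t, ht, isGLB_bot_iff.2 fun Y hY =>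
    hi _ (h _ inf_le_left fun X hX => inf_le_right.trans (hY X hX))⟩

theorem FinCogen.of_shortExact {S : ShortComplex C} (hS : S.ShortExact) (h₁ : FinCogen S.X₁)
    (h₃ : FinCogen S.X₃) : FinCogen S.X₂ := by
  classical
  have := hS.mono_f
  refine finCogen_iff.2 fun s hs => ?_
  obtain ⟨t, ht, h⟩ := h₁.exists_finset S.f hs
  -- The finite intersection over `t` meets `S.X₁` trivially, so it embeds in `S.X₃` and is itself
  -- finitely cogenerated.
  have hmono : Mono ((t.inf id).arrow ≫ S.g) := by
    refine Preadditive.mono_of_kernel_zero ?_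
    rw [← cancel_mono (t.inf id).arrow, zero_comp, ← Subobject.mk_eq_bot_iff_zero]
    refine h _ ?_ fun X hX => ?_
    · obtain ⟨y, hy⟩ := hS.exact.lift' (kernel.ι ((t.inf id).arrow ≫ S.g) ≫ (t.inf id).arrow)
        (by simp)
      exact Subobject.mk_le_mk_of_comm y hy
    · exact (Subobject.mk_le_of_comm _ rfl).trans (Finset.inf_le (f := id) hX)
  obtain ⟨t', ht', h'⟩ := (h₃.of_mono ((t.inf id).arrow ≫ S.g)).exists_finset (t.inf id).arrow hs
  refine ⟨t ∪ t', by simp [ht, ht'], isGLB_bot_iff.2 fun Y hY => h' _ ?_ fun X hX =>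
    hY X (by simp [hX])⟩
  rw [Subobject.mk_arrow]
  exact Finset.le_inf fun X hX => hY X (by simp [Finset.mem_coe.1 hX])

theorem FinCogen.biprod {M N : C} (hM : FinCogen M) (hN : FinCogen N) : FinCogen (M ⊞ N) :=
  FinCogen.of_shortExact (ShortComplex.Splitting.ofHasBinaryBiproduct M N).shortExact hM hN

theorem FinGen.of_epi {N M : C} (hM : FinGen M) (p : M ⟶ N) [Epi p] : FinGen N :=
  finGen_iff_finCogen_op.2 ((finGen_iff_finCogen_op.1 hM).of_mono p.op)

theorem FinGen.of_shortExact {S : ShortComplex C} (hS : S.ShortExact) (h₁ : FinGen S.X₁)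
    (h₃ : FinGen S.X₃) : FinGen S.X₂ :=
  finGen_iff_finCogen_op.2 (FinCogen.of_shortExact hS.op (finGen_iff_finCogen_op.1 h₃)
    (finGen_iff_finCogen_op.1 h₁))

theorem FinGen.biprod {M N : C} (hM : FinGen M) (hN : FinGen N) : FinGen (M ⊞ N) :=
  FinGen.of_shortExact (ShortComplex.Splitting.ofHasBinaryBiproduct M N).shortExact hM hN

theorem finGen_zero : FinGen (0 : C) := by
  have := Subobject.subsingleton_of_isZero (isZero_zero C)
  exact fun S _ => ⟨∅, by simp, Subsingleton.elim _ _⟩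

end Finiteness

/-! ### Projective covers by sums of generators. -/

section Generators

open ZeroObject

variable {C : Type u} [Category.{v} C] [Abelian C]

theorem FinGen.exists_epi_of_isSeparating {ι : Type*} {G : ι → C}
    (hG : ∀ i, FinGen (G i) ∧ Projective (G i)) (hsep : (ObjectProperty.ofObj G).IsSeparating)
    {N : C} (hN : FinGen N) :
    ∃ (P : C) (p : P ⟶ N), FinGen P ∧ Projective P ∧ Epi p := by
  classical
  -- The images of all maps from generators have sum `N`: the cokernel of any upper bound kills
  -- every such map. Finitely many images then suffice.
  obtain ⟨t, ht, htop⟩ := hN {X | ∃ (i : ι) (f : G i ⟶ N), X = imageSubobject f}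
    ⟨fun _ _ => le_top, fun Y hY => by
      rw [top_le_iff, ← cokernel_π_eq_zero_iff]
      refine hsep _ _ fun _ hA f => ?_
      obtain ⟨i⟩ := hA
      have hf := hY ⟨i, f, rfl⟩
      rw [← imageSubobject_arrow_comp f, ← Subobject.ofLE_arrow hf, Category.assoc, Category.assoc,
        cokernel.condition, comp_zero, comp_zero, comp_zero]⟩
  suffices H : ∀ t : Finset (Subobject N),
      (t : Set (Subobject N)) ⊆ {X | ∃ (i : ι) (f : G i ⟶ N), X = imageSubobject f} →
      ∃ (P : C) (p : P ⟶ N), FinGen P ∧ Projective P ∧ t.sup id ≤ imageSubobject p by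
    obtain ⟨P, p, hP, hP', hp⟩ := H t ht
    refine ⟨P, p, hP, hP', ?_⟩
    rw [htop, top_le_iff, ← Subobject.isIso_arrow_iff_eq_top] at hp
    rw [← imageSubobject_arrow_comp p]
    infer_instance
  intro t
  induction t using Finset.induction_on with
  | empty => exact fun _ => ⟨0, 0, finGen_zero, inferInstance, by simp⟩
  | insert X t _ ih =>
    intro ht
    rw [Finset.coe_insert, Set.insert_subset_iff] at ht
    obtain ⟨P, p, hP, hP', hp⟩ := ih ht.2
    obtain ⟨i, f, hf⟩ := ht.1
    have := (hG i).2
    refine ⟨G i ⊞ P, biprod.desc f p, (hG i).1.biprod hP, inferInstance, ?_⟩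
    rw [Finset.sup_insert]
    refine sup_le ?_ (hp.trans ?_)
    · rw [id, hf]
      simpa using imageSubobject_comp_le biprod.inl (biprod.desc f p)
    · simpa using imageSubobject_comp_le biprod.inr (biprod.desc f p)

theorem exists_epi_of_isSeparating [LocallySmall.{w} C] [HasCoproducts.{w} C] {ι : Type w}
    {G : ι → C} (hG : ∀ i, Projective (G i)) (hsep : (ObjectProperty.ofObj G).IsSeparating)
    (N : C) : ∃ (P : C) (p : P ⟶ N), Projective P ∧ Epi p := by
  let F : (Σ i, Shrink.{w} (G i ⟶ N)) → C := fun x => G x.1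
  let p : ∐ F ⟶ N := Sigma.desc fun x => (equivShrink (G x.1 ⟶ N)).symm x.2
  refine ⟨∐ F, p, ⟨fun f e _ => ?_⟩, ?_⟩
  · exact ⟨Sigma.desc fun x => Projective.factorThru (Sigma.ι F x ≫ f) e, by ext; simp⟩
  · refine Preadditive.epi_of_cancel_zero _ fun x hx => hsep _ _ fun _ hA f => ?_
    obtain ⟨i⟩ := hA
    have hf : Sigma.ι F ⟨i, equivShrink (G i ⟶ N) f⟩ ≫ p = f :=
      (Sigma.ι_desc _ _).trans (Equiv.symm_apply_apply _ _)
    rw [← hf, Category.assoc, hx]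
    simp

end Generators

/-! ### Complements and injective hulls in a Grothendieck category. -/

section InjectiveHull

variable {C : Type u} [Category.{v} C] [Abelian C] [IsGrothendieckAbelian.{w} C]

/-- The union of a directed family of subobjects that meet `Y` trivially meets `Y` trivially. -/
theorem exists_isLUB_range_of_monotone {J : Type w} [Preorder J] [IsDirectedOrder J] [Nonempty J]
    {E : C} {K : J → Subobject E} (hK : Monotone K) :
    ∃ A, IsLUB (Set.range K) A ∧ ∀ Y : Subobject E, (∀ j, Y ⊓ K j = ⊥) → Y ⊓ A = ⊥ := by
  let F : J ⥤ MonoOver E :=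
    { obj j := MonoOver.mk (K j).arrow
      map f := MonoOver.homMk (Subobject.ofLE _ _ (hK (leOfHom f))) }
  let f : colimit (F ⋙ MonoOver.forget _ ⋙ Over.forget _) ⟶ E :=
    colimit.desc (F ⋙ MonoOver.forget _ ⋙ Over.forget _)
      (Cocone.mk E
        { app j := (K j).arrow
          naturality _ _ g :=
            (Subobject.ofLE_arrow (hK (leOfHom g))).trans (Category.comp_id _).symm })
  have hf : ∀ j, colimit.ι (F ⋙ MonoOver.forget _ ⋙ Over.forget _) j ≫ f = (K j).arrow :=
    fun j => colimit.ι_desc _ _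
  have hfm : Mono f :=
    IsGrothendieckAbelian.mono_of_isColimit_monoOver F (colimit.isColimit _) f hf
  have hsup := IsGrothendieckAbelian.subobjectMk_of_isColimit_eq_iSup F (colimit.isColimit _) f hf
  have hFK : (fun j => Subobject.mk (F.obj j).obj.hom) = K :=
    funext fun j => Subobject.mk_arrow (K j)
  refine ⟨Subobject.mk f, ?_, fun Y hY => ?_⟩
  · rw [hsup, hFK]
    exact isLUB_iSup
  · rw [inf_eq_bot_iff_mono, ← Subobject.underlyingIso_hom_comp_eq_mk, Category.assoc]
    -- This map is the filtered colimit of the monomorphisms `K j ⟶ E / Y`, hence a monomorphism by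
    -- exactness of filtered colimits.
    suffices Mono (f ≫ cokernel.π Y.arrow) by infer_instance
    let α : F ⋙ MonoOver.forget _ ⋙ Over.forget _ ⟶ (Functor.const J).obj (cokernel Y.arrow) :=
      { app j := (K j).arrow ≫ cokernel.π Y.arrow
        naturality _ _ g :=
          (Subobject.ofLE_arrow_assoc (hK (leOfHom g)) _).trans (Category.comp_id _).symm }
    have (j : J) : Mono (α.app j) := (inf_eq_bot_iff_mono _ _).1 (hY j)
    have := NatTrans.mono_of_mono_app α
    have : IsConnected J := IsFiltered.isConnected J
    refine colim.map_mono' α (colimit.isColimit _) (isColimitConstCocone J _) _ fun j => ?_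
    exact (Category.assoc _ _ _).symm.trans ((hf j =≫ _).trans (Category.comp_id _).symm)

theorem exists_isLUB_of_isChain {E : C} {c : Set (Subobject E)} (hc : IsChain (· ≤ ·) c)
    (hne : c.Nonempty) :
    ∃ A, IsLUB c A ∧ ∀ Y : Subobject E, (∀ K ∈ c, Y ⊓ K = ⊥) → Y ⊓ A = ⊥ := by
  -- The chain is small, so it can be indexed in the universe `w` of the available filtered
  -- colimits.
  let K : Shrink.{w} c → Subobject E := fun j => ((equivShrink c).symm j).1
  have hKc : ∀ j, K j ∈ c := fun j => ((equivShrink c).symm j).2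
  have hle : ∀ {i j}, K i ≤ K j → i ≤ j := fun h => h
  have : Nonempty (Shrink.{w} c) := hne.to_subtype.map (equivShrink c)
  have : IsDirectedOrder (Shrink.{w} c) := ⟨fun i j => by
    rcases hc.total (hKc i) (hKc j) with h | h
    · exact ⟨j, hle h, le_rfl⟩
    · exact ⟨i, le_rfl, hle h⟩⟩
  have hrange : Set.range K = c := by
    rw [show K = Subtype.val ∘ (equivShrink c).symm from rfl, Set.range_comp,
      Equiv.range_eq_univ, Set.image_univ, Subtype.range_coe]
  obtain ⟨A, hA, h⟩ := exists_isLUB_range_of_monotone (K := K) fun _ _ h => h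
  exact ⟨A, hrange ▸ hA, fun Y hY => h Y fun j => hY _ (hKc j)⟩

theorem inf_kernelSubobject_eq_bot {D : Type u} [Category.{v} D] [Abelian D] {L M : D}
    (K : Subobject L) (m : L ⟶ M) [Mono (K.arrow ≫ m)] : K ⊓ kernelSubobject m = ⊥ := by
  have h0 : Subobject.ofLE (K ⊓ kernelSubobject m) K inf_le_left = 0 := by
    rw [← cancel_mono (K.arrow ≫ m), Subobject.ofLE_arrow_assoc, zero_comp,
      ← Subobject.ofLE_arrow (inf_le_right : K ⊓ kernelSubobject m ≤ _), Category.assoc,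
      kernelSubobject_arrow_comp, comp_zero]
  rw [← arrow_eq_zero_iff, ← Subobject.ofLE_arrow (inf_le_left : K ⊓ kernelSubobject m ≤ K), h0,
    zero_comp]

/-- Every subobject `K` has a complement `X`, maximal among the subobjects meeting `K` trivially,
and `K` is essential in the quotient by `X`. -/
theorem exists_essentialMono_arrow_comp_cokernel {E : C} (K : Subobject E) :
    ∃ X : Subobject E, EssentialMono (K.arrow ≫ cokernel.π X.arrow) := by
  obtain ⟨X, -, hX⟩ := zorn_le_nonempty₀ {X : Subobject E | K ⊓ X = ⊥} (fun c hcs hc y hy => by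
    obtain ⟨A, hA, h⟩ := exists_isLUB_of_isChain hc ⟨y, hy⟩
    exact ⟨A, h K hcs, hA.1⟩) ⊥ (inf_bot_eq K)
  have hKX : K ⊓ X = ⊥ := hX.prop
  refine ⟨X, (inf_eq_bot_iff_mono X K).1 (by rwa [inf_comm]), fun P h hm => ?_⟩
  -- This kernel contains `X` and still meets `K` trivially, so maximality of `X` applies.
  have hX' : kernelSubobject (cokernel.π X.arrow ≫ h) ≤ X := by
    rw [Category.assoc] at hm
    exact hX.le_of_ge (inf_kernelSubobject_eq_bot K _) (le_kernelSubobject _ _ (by simp))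
  refine Preadditive.mono_of_cancel_zero _ fun y hy => ?_
  obtain ⟨T, e, he, x, hx⟩ := surjective_up_to_refinements_of_epi (cokernel.π X.arrow) y
  have hfac : X.Factors x := Subobject.factors_of_le _ hX'
    (kernelSubobject_factors _ _ (by rw [← reassoc_of% hx, hy, comp_zero]))
  rw [← cancel_epi e, hx, comp_zero, ← Subobject.factorThru_arrow X x hfac, Category.assoc,
    cokernel.condition, comp_zero]

/-- The hull is a maximal essential extension `K` of `N` inside an injective `E`. With `X` a
complement of `K`, the inclusion `K ⟶ E` extends along the essential monomorphism `K ⟶ E / X` to a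
monomorphism `φ`. Its image is again essential over `N`, so it equals `K` by maximality. Thus `E ⟶ E
/ X ⟶ K` is a retraction, and `K` is injective. -/
theorem exists_injective_hull (N : C) :
    ∃ (E : C) (i : N ⟶ E) (_ : Mono i), Injective E ∧ EssentialSubobject (Subobject.mk i) := by
  let E := Injective.under N
  let N₀ : Subobject E := Subobject.mk (Injective.ι N)
  obtain ⟨K, hNK, hK⟩ := zorn_le_nonempty₀
    {K : Subobject E | N₀ ≤ K ∧ ∀ X ≤ K, N₀ ⊓ X = ⊥ → X = ⊥} (fun c hcs hc y hy => by
      obtain ⟨A, hA, h⟩ := exists_isLUB_of_isChain hc ⟨y, hy⟩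
      refine ⟨A, ⟨(hcs hy).1.trans (hA.1 hy), fun X hXA hX => ?_⟩, hA.1⟩
      rw [← inf_eq_left.2 hXA]
      refine h X fun K hK => (hcs hK).2 _ inf_le_right (le_bot_iff.1 ?_)
      rw [← hX]
      exact inf_le_inf_left _ inf_le_left) N₀
    ⟨le_rfl, fun X hX h => by rwa [inf_eq_right.2 hX] at h⟩
  obtain ⟨X, hj⟩ := exists_essentialMono_arrow_comp_cokernel K
  set j := K.arrow ≫ cokernel.π X.arrow with hj_def
  have hjm : Mono j := hj.1
  let φ : cokernel X.arrow ⟶ E := Injective.factorThru K.arrow j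
  have hφ : j ≫ φ = K.arrow := Injective.comp_factorThru _ _
  have hφm : Mono φ := hj.2 φ (by rw [hφ]; infer_instance)
  have hKφ : K ≤ Subobject.mk φ := Subobject.le_mk_of_comm j hφ
  have hφK : Subobject.mk φ ≤ K := by
    refine hK.le_of_ge ⟨hNK.trans hKφ, fun Y hY hNY => ?_⟩ hKφ
    obtain ⟨Y, rfl⟩ := exists_map_eq φ hY
    rw [map_eq_bot_iff]
    refine hj.essentialSubobject_mk Y ?_
    rw [← map_eq_bot_iff φ, Subobject.inf_map, Subobject.map_mk]
    have hKφ' : Subobject.mk (j ≫ φ) = K := by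
      simp only [hφ, Subobject.mk_arrow]
    rw [hKφ']
    refine hK.prop.2 _ inf_le_left (le_bot_iff.1 ?_)
    rw [← hNY]
    exact inf_le_inf_left _ inf_le_right
  let ψ := Subobject.ofMkLE φ K hφK
  have hψ : ψ ≫ K.arrow = φ := Subobject.ofMkLE_arrow _
  refine ⟨K, Subobject.ofMkLE _ K hNK, inferInstance, ?_, fun Y hY => ?_⟩
  · refine Retract.injective (Y := E) ⟨K.arrow, cokernel.π X.arrow ≫ ψ, ?_⟩
    rw [← cancel_mono K.arrow, Category.assoc, Category.assoc, hψ, ← Category.assoc, ← hj_def, hφ,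
      Category.id_comp]
  · rw [← map_eq_bot_iff K.arrow, Subobject.inf_map, Subobject.map_mk] at hY
    have hN : Subobject.mk (Subobject.ofMkLE (Injective.ι N) K hNK ≫ K.arrow) = N₀ := by
      simp only [Subobject.ofMkLE_arrow, N₀]
    rw [hN] at hY
    rw [← map_eq_bot_iff K.arrow]
    refine hK.prop.2 _ (((Subobject.map K.arrow).monotone le_top).trans_eq ?_) hY
    rw [Subobject.map_top, Subobject.mk_arrow]

theorem FinCogen.exists_mono_injective {N : C} (hN : FinCogen N) :
    ∃ (E : C) (i : N ⟶ E), FinCogen E ∧ Injective E ∧ Mono i := by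
  obtain ⟨E, i, hi, hE, hess⟩ := exists_injective_hull N
  exact ⟨E, i, hN.of_essential i hess, hE, hi⟩

end InjectiveHull

end CSRickart

theorem theoremt {C : Type u} [Category.{v} C] [Abelian C] [IsGrothendieckAbelian.{w} C] :
    (CSRickart.HasFinGenProjectiveGenerators.{w} C →
      ((∀ M : C, Projective M → CSRickart.WeaklyHereditary M) ↔
        (∀ M : C, Projective M → CSRickart.SelfCSRickart M)) ∧
      ((∀ M : C, CSRickart.FinGen M → Projective M → CSRickart.WeaklySemihereditary M) ↔
        (∀ M : C, CSRickart.FinGen M → Projective M → CSRickart.SelfCSRickart M))) ∧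
    (CSRickart.LocallyFinGen.{w} C →
      ((∀ M : C, Injective M → CSRickart.WeaklyCohereditary M) ↔
        (∀ M : C, Injective M → CSRickart.DualSelfCSRickart M)) ∧
      ((∀ M : C, CSRickart.FinCogen M → Injective M → CSRickart.WeaklySemicohereditary M) ↔
        (∀ M : C, CSRickart.FinCogen M → Injective M → CSRickart.DualSelfCSRickart M))) := by
  refine ⟨fun ⟨ι, G, hG, hsep⟩ => ⟨⟨fun h M hM => ?_, fun h M hM N i _ => ?_⟩,
    ⟨fun h M hfg hM => ?_, fun h M hfg hM N i _ hN => ?_⟩⟩, fun _ =>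
    ⟨⟨fun h M hM => ?_, fun h M hM N p _ => ?_⟩,
    ⟨fun h M hfg hM => ?_, fun h M hfg hM N p _ hN => ?_⟩⟩⟩
  · exact CSRickart.selfCSRickart_of_image fun f => h M hM (image.ι f) inferInstance
  · obtain ⟨P, p, hP, hp⟩ := CSRickart.exists_epi_of_isSeparating (fun i => (hG i).2) hsep N
    exact CSRickart.exists_iso_biprod_of_selfCSRickart_biprod (h (P ⊞ M) inferInstance) p i
  · exact CSRickart.selfCSRickart_of_image fun f => h M hfg hM (image.ι f) inferInstance
      (hfg.of_epi (factorThruImage f))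
  · obtain ⟨P, p, hPfg, hP, hp⟩ := hN.exists_epi_of_isSeparating hG hsep
    exact CSRickart.exists_iso_biprod_of_selfCSRickart_biprod
      (h (P ⊞ M) (hPfg.biprod hfg) inferInstance) p i
  · exact CSRickart.dualSelfCSRickart_of_image fun f => h M hM (factorThruImage f) inferInstance
  · exact CSRickart.exists_iso_biprod_of_dualSelfCSRickart_biprod
      (h (M ⊞ Injective.under N) inferInstance) p (Injective.ι N)
  · exact CSRickart.dualSelfCSRickart_of_image fun f => h M hfg hM (factorThruImage f)
      inferInstance (hfg.of_mono (image.ι f))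
  · obtain ⟨E, i, hEfg, hE, hi⟩ := hN.exists_mono_injective
    exact CSRickart.exists_iso_biprod_of_dualSelfCSRickart_biprod
      (h (M ⊞ E) (hfg.biprod hEfg) inferInstance) p i
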